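/- Let $k\in\mathbb{N}$, let $\Delta^k=\{z\in\mathbb{R}^k : z_i\ge 0,\ \sum_{i=1}^k z_i=1\}$ with the Euclidean norm, and let $H=\{z\in\mathbb{R}^k:\sum_{i=1}^k z_i=1\}$ be the hyperplane that contains it. For a sequence $x\colon\mathbb{N}\to[k]$ (indexed from $1$), let $r^x(n)\in\Delta^k$ be the vector of relative frequencies, $r^x_i(n)=\frac1n\,|\{j\in\{1,\dots,n\}: x(j)=i\}|$, and let $\operatorname{CP}(r^x)$ be the set of its cluster points, i.e. of all $z\in\Delta^k$ such that for every $\epsilon>0$ there are infinitely many $n$ with $\|r^x(n)-z\|<\epsilon$. Let $D\subseteq\Delta^k$ be a non-empty convex set. (1) Suppose that $k\ge 3$, or that $k=2$ and $D$ is a single point. Then there is a sequence $x\colon\mathbb{N}\to[k]$ with $\operatorname{CP}(r^x)=\partial D$, where $\partial D$ is the topological boundary of $D$ in $H$. (2) Suppose that the affine hull of $D$ has dimension at least $2$. Then there is a sequence $x\colon\mathbb{N}\to[k]$ with $\operatorname{CP}(r^x)=\operatorname{relbd} D$, where $\operatorname{relbd}D$ is the relative boundary of $D$, i.e. its topological boundary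 in its own affine hull. (If $D$ has non-empty interior in $H$, then $\partial D=\operatorname{relbd}D$.) -/

import Mathlib

/-- The `(k-1)`-simplex `Δ^k` in `ℝ^k` with the Euclidean norm. -/
def simplex (k : ℕ) : Set (EuclideanSpace ℝ (Fin k)) :=
  {z | (∀ i, 0 ≤ z i) ∧ ∑ i, z i = 1}

/-- The relative frequencies of a sequence `x 0, x 1, x 2, …` of letters: the `i`-th coordinate of
`relFreq x n` is the proportion of the letter `i` among the first `n + 1` terms `x 0, …, x n`.
(With sequences indexed from `1`, this is `r^x (n + 1)`.) -/
noncomputable def relFreq {k : ℕ} (x : ℕ → Fin k) (n : ℕ) : EuclideanSpace ℝ (Fin k) :=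
  WithLp.toLp 2 fun i =>
    (((Finset.range (n + 1)).filter fun j => x j = i).card : ℝ) / ((n : ℝ) + 1)

/-- Relative frequencies are points of the simplex. -/
theorem relFreq_mem_simplex {k : ℕ} (x : ℕ → Fin k) (n : ℕ) : relFreq x n ∈ simplex k := by
  refine ⟨fun i => ?_, ?_⟩
  · simp only [relFreq]
    positivity
  · have h : ∑ i, ((Finset.range (n + 1)).filter fun j => x j = i).card = n + 1 := by
      rw [← Finset.card_eq_sum_card_fiberwise (fun _ _ => Finset.mem_coe.2 (Finset.mem_univ _)),
        Finset.card_range]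
    have h' : (n : ℝ) + 1 ≠ 0 := by positivity
    simp only [relFreq]
    rw [← Finset.sum_div, ← Nat.cast_sum, h, Nat.cast_add, Nat.cast_one, div_self h']

/-- The `ε`-neighbourhood of `z` in the simplex, for the Euclidean norm. -/
def simplexBall {k : ℕ} (z : EuclideanSpace ℝ (Fin k)) (ε : ℝ) : Set (EuclideanSpace ℝ (Fin k)) :=
  {p ∈ simplex k | ‖p - z‖ < ε}

/-- The set of cluster points in the simplex of a sequence `r` of points: those `z` each of whose
`ε`-neighbourhoods is visited by `r` at infinitely many times. -/
def clusterPoints {k : ℕ} (r : ℕ → EuclideanSpace ℝ (Fin k)) : Set (EuclideanSpace ℝ (Fin k)) :=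
  {z ∈ simplex k | ∀ ε : ℝ, 0 < ε → {n : ℕ | r n ∈ simplexBall z ε}.Infinite}

/-- The hyperplane `{z : z_1 + ⋯ + z_k = 1}` spanned by the simplex. -/
def simplexPlane (k : ℕ) : Set (EuclideanSpace ℝ (Fin k)) :=
  {z | ∑ i, z i = 1}

/-- The topological boundary of (the part in `simplexPlane k` of) `D`, taken within the
`(k-1)`-dimensional hyperplane `simplexPlane k`. -/
def planeBoundary {k : ℕ} (D : Set (EuclideanSpace ℝ (Fin k))) : Set (EuclideanSpace ℝ (Fin k)) :=
  Subtype.val '' frontier (Subtype.val ⁻¹' D : Set (simplexPlane k))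

/-! Only three properties of the boundary matter: it is non-empty, closed and connected. Any such
`C` in the simplex is a cluster set (`exists_clusterPoints_relFreq_eq`). Connectedness gives a
sequence in `C` with steps tending to zero that clusters at every point of `C`. Holding each of its
terms as a target for a very long time, a greedy choice of letters keeps the unnormalised error of
order `√n`, so the frequencies follow the target.

The boundary of a bounded convex set is connected in dimension at least 2, being a sphere or,
without interior, the closure of the set. On a line it may be two points, which is why `k = 2` needs
a single point. -/

/-! ### Boundaries of bounded convex sets -/

theorem frontier_nonempty_of_isBounded {E : Type*} [NormedAddCommGroup E] [NormedSpace ℝ E]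
    [Nontrivial E] {s : Set E} (hne : s.Nonempty) (hb : Bornology.IsBounded s) :
    (frontier s).Nonempty := by
  rw [Set.nonempty_iff_ne_empty, Ne, ← isClopen_iff_frontier_eq_empty, isClopen_iff]
  rintro (rfl | rfl)
  · exact Set.not_nonempty_empty hne
  · exact NormedSpace.unbounded_univ ℝ E hb

theorem Convex.isConnected_frontier {E : Type*} [NormedAddCommGroup E] [NormedSpace ℝ E]
    (hE : 1 < Module.rank ℝ E) {s : Set E} (hs : Convex ℝ s) (hne : s.Nonempty)
    (hb : Bornology.IsBounded s) : IsConnected (frontier s) := by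
  rcases (interior s).eq_empty_or_nonempty with h | h
  · rw [← closure_sdiff_interior, h, Set.sdiff_empty]
    exact ⟨hne.closure, hs.closure.isPreconnected⟩
  · obtain ⟨e, -, -, he⟩ := exists_homeomorph_image_interior_closure_frontier_eq_unitBall hs h hb
    have h1 : IsConnected (e '' frontier s) := by
      rw [he]
      exact isConnected_sphere hE 0 zero_le_one
    exact e.isConnected_image.1 h1

/-- Translating a subset of an affine subspace to the direction turns its boundary within the
subspace into a boundary in a normed space. -/
theorem AffineSubspace.image_frontier_preimage_eq {E : Type*} [NormedAddCommGroup E]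
    [NormedSpace ℝ E] (A : AffineSubspace ℝ E) {p : E} (hp : p ∈ A) (D : Set E) :
    Subtype.val '' frontier (Subtype.val ⁻¹' D : Set (A : Set E)) =
      (fun v : A.direction => (v : E) + p) ''
        frontier ((fun v : A.direction => (v : E) + p) ⁻¹' D) := by
  have : Nonempty A := ⟨⟨p, hp⟩⟩
  let e : A.direction ≃ₜ A := (AffineIsometryEquiv.vaddConst ℝ (⟨p, hp⟩ : A)).toHomeomorph
  have he : (fun v : A.direction => (v : E) + p) = Subtype.val ∘ e := rfl
  rw [he, Set.preimage_comp, Set.image_comp]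
  have h2 := e.image_frontier (e ⁻¹' (Subtype.val ⁻¹' D))
  rw [e.image_preimage] at h2
  rw [h2]
  rfl

theorem isClosed_image_frontier_preimage {X : Type*} [TopologicalSpace X] {P : Set X}
    (hP : IsClosed P) (D : Set X) :
    IsClosed (Subtype.val '' frontier (Subtype.val ⁻¹' D : Set P)) :=
  hP.isClosedEmbedding_subtypeVal.isClosedMap _ isClosed_frontier

theorem image_frontier_preimage_subset_closure {X : Type*} [TopologicalSpace X] (P D : Set X) :
    Subtype.val '' frontier (Subtype.val ⁻¹' D : Set P) ⊆ closure D :=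
  Set.image_subset_iff.2 <| frontier_subset_closure.trans <|
    continuous_subtype_val.closure_preimage_subset _

theorem isBounded_preimage_add {E : Type*} [NormedAddCommGroup E]
    [NormedSpace ℝ E] (V : Submodule ℝ E) (p : E) {D : Set E} (hb : Bornology.IsBounded D) :
    Bornology.IsBounded ((fun v : V => (v : E) + p) ⁻¹' D) := by
  obtain ⟨r, hr⟩ := hb.subset_closedBall p
  refine (Metric.isBounded_closedBall (x := (0 : V)) (r := r)).subset fun v hv => ?_
  simpa [dist_eq_norm] using hr hv

theorem AffineSubspace.nonempty_image_frontier_preimage {E : Type*} [NormedAddCommGroup E]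
    [NormedSpace ℝ E] (A : AffineSubspace ℝ E) [Nontrivial A.direction] {D : Set E}
    (hDA : D ⊆ A) (hne : D.Nonempty) (hb : Bornology.IsBounded D) :
    (Subtype.val '' frontier (Subtype.val ⁻¹' D : Set (A : Set E))).Nonempty := by
  obtain ⟨p, hp⟩ := hne
  rw [A.image_frontier_preimage_eq (hDA hp)]
  exact (frontier_nonempty_of_isBounded ⟨0, by simpa using hp⟩
    (isBounded_preimage_add _ p hb)).image _

theorem AffineSubspace.isConnected_image_frontier_preimage {E : Type*} [NormedAddCommGroup E]
    [NormedSpace ℝ E] (A : AffineSubspace ℝ E) (hA : 1 < Module.rank ℝ A.direction) {D : Set E}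
    (hDA : D ⊆ A) (hD : Convex ℝ D) (hne : D.Nonempty) (hb : Bornology.IsBounded D) :
    IsConnected (Subtype.val '' frontier (Subtype.val ⁻¹' D : Set (A : Set E))) := by
  obtain ⟨p, hp⟩ := hne
  rw [A.image_frontier_preimage_eq (hDA hp)]
  refine (Convex.isConnected_frontier hA ?_ ⟨0, by simpa using hp⟩
    (isBounded_preimage_add _ p hb)).image _ (by fun_prop)
  exact (hD.translate_preimage_left p).linear_preimage A.direction.subtype

/-! ### The simplex and its hyperplane -/

theorem isClosed_simplex (k : ℕ) : IsClosed (simplex k) := by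
  have : simplex k = (⋂ i, {z | 0 ≤ z i}) ∩ {z | ∑ i, z i = 1} := by
    ext z; simp [simplex]
  rw [this]
  refine (isClosed_iInter fun i => isClosed_le continuous_const (by fun_prop)).inter
    (isClosed_eq (by fun_prop) continuous_const)

theorem norm_le_one_of_mem_simplex {k : ℕ} {z : EuclideanSpace ℝ (Fin k)} (hz : z ∈ simplex k) :
    ‖z‖ ≤ 1 := by
  rw [← sq_le_one_iff₀ (norm_nonneg z), EuclideanSpace.real_norm_sq_eq, ← hz.2]
  refine Finset.sum_le_sum fun i hi => ?_
  have h1 : z i ≤ 1 := hz.2 ▸ Finset.single_le_sum (f := fun i => z i) (fun j _ => hz.1 j) hi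
  nlinarith [hz.1 i]

theorem isBounded_simplex (k : ℕ) : Bornology.IsBounded (simplex k) :=
  isBounded_iff_forall_norm_le.2 ⟨1, fun _ h => norm_le_one_of_mem_simplex h⟩

theorem isClosed_simplexPlane (k : ℕ) : IsClosed (simplexPlane k) :=
  isClosed_eq (by fun_prop) continuous_const

/-- The hyperplane containing the simplex is an affine subspace of dimension `k - 1`. -/
theorem exists_affineSubspace_eq_simplexPlane {k : ℕ} (hk : k ≠ 0) :
    ∃ A : AffineSubspace ℝ (EuclideanSpace ℝ (Fin k)),
      (A : Set (EuclideanSpace ℝ (Fin k))) = simplexPlane k ∧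
      Module.finrank ℝ A.direction + 1 = k := by
  let φ : EuclideanSpace ℝ (Fin k) →ₗ[ℝ] ℝ :=
    { toFun := fun z => ∑ i, z i
      map_add' := fun x y => by simp [Finset.sum_add_distrib]
      map_smul' := fun c x => by simp [Finset.mul_sum] }
  let p : EuclideanSpace ℝ (Fin k) := EuclideanSpace.single ⟨0, Nat.pos_of_ne_zero hk⟩ 1
  have hp : φ p = 1 := by simp [φ, p, PiLp.single_apply]
  have hφ : φ ≠ 0 := fun h => by simp [h] at hp
  refine ⟨AffineSubspace.mk' p (LinearMap.ker φ), ?_, ?_⟩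
  · ext z
    have : φ z = ∑ i, z i := rfl
    simp [AffineSubspace.mem_mk', simplexPlane, sub_eq_zero, hp, this]
  · rw [AffineSubspace.direction_mk', Module.Dual.finrank_ker_add_one_of_ne_zero hφ]
    simp

/-! ### Exploring a connected space by small steps -/

/-- Being joined by an `ε`-chain is transitive and holds both ways between nearby points, so in a
connected space it holds for all pairs. -/
theorem exists_chain_of_preconnectedSpace {X : Type*} [PseudoMetricSpace X] [PreconnectedSpace X]
    {ε : ℝ} (hε : 0 < ε) (x y : X) :
    ∃ n, 0 < n ∧ ∃ g : ℕ → X, g 0 = x ∧ g n = y ∧ ∀ i < n, dist (g i) (g (i + 1)) < ε := by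
  have key : ∀ a b : X, dist a b < ε →
      ∃ n, 0 < n ∧ ∃ g : ℕ → X, g 0 = a ∧ g n = b ∧ ∀ i < n, dist (g i) (g (i + 1)) < ε := by
    intro a b h
    refine ⟨1, one_pos, fun i => if i = 0 then a else b, by simp, by simp, fun i hi => ?_⟩
    obtain rfl : i = 0 := by omega
    simpa using h
  refine PreconnectedSpace.induction₂' (fun a b : X =>
    ∃ n, 0 < n ∧ ∃ g : ℕ → X, g 0 = a ∧ g n = b ∧ ∀ i < n, dist (g i) (g (i + 1)) < ε)
    (fun z => ?_) ⟨?_⟩ x y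
  · filter_upwards [Metric.ball_mem_nhds z hε] with w hw
    exact ⟨key z w (by rwa [dist_comm]), key w z hw⟩
  · rintro a b c ⟨n, hn, g, hg0, hgn, hg⟩ ⟨m, hm, f, hf0, hfm, hf⟩
    refine ⟨n + m, by omega, fun i => if i < n then g i else f (i - n), by simp [hn, hg0],
      by simp [hfm], fun i hi => ?_⟩
    rcases lt_trichotomy (i + 1) n with h | h | h
    · simpa [h, (by omega : i < n)] using hg i (by omega)
    · have := hg i (by omega)
      rw [h, hgn, ← hf0] at this
      simpa [h, (by omega : i < n)] using this
    · have := hf (i - n) (by omega)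
      rw [← Nat.sub_add_comm (by omega)] at this
      have h1 : ¬ i + 1 < n := by omega
      have h2 : ¬ i < n := by omega
      simpa only [if_neg h1, if_neg h2] using this

open Filter Topology in
/-- A separable connected space can be explored by a sequence whose steps tend to zero. -/
theorem exists_seq_mapClusterPt_of_preconnectedSpace {X : Type*} [PseudoMetricSpace X]
    [PreconnectedSpace X] [TopologicalSpace.SeparableSpace X] [Nonempty X] :
    ∃ c : ℕ → X, Tendsto (fun m => dist (c m) (c (m + 1))) atTop (𝓝 0) ∧
      ∀ z, MapClusterPt z atTop c := by
  -- Unpairing makes every point of the dense sequence recur infinitely often.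
  let d : ℕ → X := fun m => TopologicalSpace.denseSeq X m.unpair.1
  choose L hL g hg0 hgL hg using fun m : ℕ =>
    exists_chain_of_preconnectedSpace (Nat.one_div_pos_of_nat (α := ℝ) (n := m)) (d m) (d (m + 1))
  -- The state `(m, i)` is position `i` on chain `m`. The end of a chain is skipped, as it is the
  -- start of the next one.
  let σ : ℕ × ℕ → ℕ × ℕ := fun s => if s.2 + 1 < L s.1 then (s.1, s.2 + 1) else (s.1 + 1, 0)
  let s : ℕ → ℕ × ℕ := fun t => σ^[t] (0, 0)
  have hs : ∀ t, s (t + 1) = σ (s t) := fun t => Function.iterate_succ_apply' _ _ _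
  have hlt : ∀ t, (s t).2 < L (s t).1 := by
    intro t
    induction t with
    | zero => exact hL 0
    | succ t ih =>
      rw [hs]
      by_cases h : (s t).2 + 1 < L (s t).1
      · simp [σ, h]
      · simp [σ, h, hL]
  have hmono : Monotone fun t => (s t).1 := by
    refine monotone_nat_of_le_succ fun t => ?_
    rw [hs]
    simp only [σ]
    split_ifs <;> simp
  have hle : ∀ t, (s t).1 ≤ t := by
    intro t
    induction t with
    | zero => exact le_rfl
    | succ t ih =>
      rw [hs]
      simp only [σ]
      split_ifs <;> simp <;> omega
  have hvisit : ∀ m, ∃ t, s t = (m, 0) := by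
    intro m
    induction m with
    | zero => exact ⟨0, rfl⟩
    | succ m ih =>
      obtain ⟨t, ht⟩ := ih
      have h : ∀ i < L m, s (t + i) = (m, i) := by
        intro i
        induction i with
        | zero => exact fun _ => ht
        | succ i ih =>
          intro hi
          rw [← add_assoc, hs, ih (by omega)]
          simp [σ, hi]
      refine ⟨t + (L m - 1) + 1, ?_⟩
      have := hL m
      rw [hs, h _ (by omega)]
      exact if_neg (by simp only; omega)
  have htend : Tendsto (fun t => (s t).1) atTop atTop :=
    tendsto_atTop_atTop_of_monotone hmono fun m => by
      obtain ⟨t, ht⟩ := hvisit m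
      exact ⟨t, by simp [ht]⟩
  have hstep : ∀ t, dist (g (s t).1 (s t).2) (g (s (t + 1)).1 (s (t + 1)).2)
      ≤ 1 / (((s t).1 : ℝ) + 1) := by
    intro t
    have h1 := (hg (s t).1 (s t).2 (hlt t)).le
    rw [hs]
    by_cases h : (s t).2 + 1 < L (s t).1
    · simpa [σ, h] using h1
    · rw [(by have := hlt t; omega : (s t).2 + 1 = L (s t).1), hgL] at h1
      simpa [σ, h, hg0] using h1
  refine ⟨fun t => g (s t).1 (s t).2, ?_, fun z => ?_⟩
  · exact squeeze_zero (fun _ => dist_nonneg) hstep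
      ((tendsto_one_div_add_atTop_nhds_zero_nat (𝕜 := ℝ)).comp htend)
  · rw [mapClusterPt_iff_frequently]
    intro U hU
    obtain ⟨j, hj⟩ := (TopologicalSpace.denseRange_denseSeq X).exists_mem_open isOpen_interior
      ⟨z, mem_interior_iff_mem_nhds.2 hU⟩
    rw [frequently_atTop]
    intro N
    obtain ⟨t, ht⟩ := hvisit (Nat.pair j N)
    refine ⟨t, (Nat.right_le_pair j N).trans ?_, ?_⟩
    · simpa [ht] using hle t
    · simpa [ht, hg0, d] using interior_subset hj

/-! ### Greedy letters that track a slowly moving target -/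

/-- The inner product is a weighted average of the coordinates of `v`, so the least coordinate does
not exceed it. -/
theorem exists_apply_le_inner {k : ℕ} {y : EuclideanSpace ℝ (Fin k)} (hy : y ∈ simplex k)
    (v : EuclideanSpace ℝ (Fin k)) : ∃ i, v i ≤ inner ℝ v y := by
  have : Nonempty (Fin k) := by
    by_contra h
    rw [not_nonempty_iff] at h
    simpa using hy.2
  obtain ⟨i, hi⟩ := Finite.exists_min fun i => v i
  refine ⟨i, ?_⟩
  have h : inner ℝ v y = ∑ j, y j * v j := by simp [PiLp.inner_apply]
  rw [h, ← one_mul (v i), ← hy.2, Finset.sum_mul]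
  exact Finset.sum_le_sum fun j _ => mul_le_mul_of_nonneg_left (hi j) (hy.1 j)

/-- The vector that counts the letters among `x 0, …, x (n - 1)`. -/
noncomputable def letterCount {k : ℕ} (x : ℕ → Fin k) (n : ℕ) : EuclideanSpace ℝ (Fin k) :=
  ∑ j ∈ Finset.range n, EuclideanSpace.single (x j) 1

theorem letterCount_succ {k : ℕ} (x : ℕ → Fin k) (n : ℕ) :
    letterCount x (n + 1) = letterCount x n + EuclideanSpace.single (x n) 1 :=
  Finset.sum_range_succ _ _

theorem relFreq_eq_smul_letterCount {k : ℕ} (x : ℕ → Fin k) (n : ℕ) :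
    relFreq x n = ((n : ℝ) + 1)⁻¹ • letterCount x (n + 1) := by
  ext i
  have h : letterCount x (n + 1) i = ((Finset.range (n + 1)).filter fun j => x j = i).card := by
    simp [letterCount, Pi.single_apply, Finset.sum_boole, eq_comm]
  simp [relFreq, h, div_eq_inv_mul]

/-- A sequence of letters in which each letter pulls the relative frequencies towards the
current target. -/
theorem exists_letters_norm_sq_le {k : ℕ} (y : ℕ → EuclideanSpace ℝ (Fin k))
    (hy : ∀ n, y n ∈ simplex k) :
    ∃ x : ℕ → Fin k, ∀ n, ‖letterCount x (n + 1) - ((n : ℝ) + 1) • y n‖ ^ 2 ≤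
      ‖letterCount x n - (n : ℝ) • y n‖ ^ 2 + 4 := by
  choose f hf using fun n v => exists_apply_le_inner (hy n) v
  let S : ℕ → EuclideanSpace ℝ (Fin k) := fun n => Nat.rec 0
    (fun n s => s + EuclideanSpace.single (f n (s - (n : ℝ) • y n)) 1) n
  let x : ℕ → Fin k := fun n => f n (S n - (n : ℝ) • y n)
  have hS : ∀ n, letterCount x n = S n := by
    intro n
    induction n with
    | zero => simp [letterCount, S]
    | succ n ih => rw [letterCount_succ, ih]
  refine ⟨x, fun n => ?_⟩
  set v := letterCount x n - (n : ℝ) • y n with hv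
  set e : EuclideanSpace ℝ (Fin k) := EuclideanSpace.single (x n) 1 with he
  have h1 : letterCount x (n + 1) - ((n : ℝ) + 1) • y n = v + (e - y n) := by
    rw [letterCount_succ, hv, add_smul, one_smul]; abel
  -- The greedy choice makes the cross term of the squared norm non-positive; what remains is `‖e -
  -- y n‖ ^ 2 ≤ 4`.
  have h2 : inner ℝ v (e - y n) ≤ 0 := by
    have h3 := hf n v
    have h4 : x n = f n v := by simp only [x, hv, hS]
    rw [← h4] at h3
    have h5 : inner ℝ v e = v (x n) := by simp [he, EuclideanSpace.inner_single_right]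
    rw [inner_sub_right, h5]
    linarith
  have h6 : ‖e - y n‖ ≤ 2 := by
    have h7 : ‖y n‖ ≤ 1 := norm_le_one_of_mem_simplex (hy n)
    have h8 : ‖e‖ = 1 := by simp [he]
    linarith [norm_sub_le e (y n)]
  rw [h1, norm_add_sq_real]
  nlinarith [norm_nonneg (e - y n)]

theorem norm_letterCount_le {k : ℕ} (x : ℕ → Fin k) (n : ℕ) : ‖letterCount x n‖ ≤ n := by
  refine (norm_sum_le _ _).trans ?_
  simp

open Filter Topology in
/-- Along a slowed-down version of `c`, the relative frequencies can track `c`. -/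
theorem exists_tendsto_relFreq_sub {k : ℕ} (c : ℕ → EuclideanSpace ℝ (Fin k))
    (hc : ∀ m, c m ∈ simplex k)
    (hstep : Tendsto (fun m => dist (c m) (c (m + 1))) atTop (𝓝 0)) :
    ∃ (x : ℕ → Fin k) (φ : ℕ → ℕ), Tendsto φ atTop atTop ∧ (∀ m, ∃ n, m ≤ n ∧ φ n = m) ∧
      Tendsto (fun n => dist (relFreq x n) (c (φ n))) atTop (𝓝 0) := by
  -- Target `m` is held from `2 ^ 2 ^ m` until the square of that time, so the error inherited at
  -- the start becomes negligible.
  let ψ : ℕ → ℕ := fun n => Nat.log 2 (Nat.log 2 n)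
  have hψ : ∀ m n, 2 ^ 2 ^ m ≤ n → n < 2 ^ 2 ^ (m + 1) → ψ n = m := by
    intro m n h1 h2
    have hn : n ≠ 0 := by have : 0 < 2 ^ 2 ^ m := by positivity
                          omega
    have h3 := (Nat.le_log_iff_pow_le one_lt_two hn).2 h1
    have h4 := (Nat.log_lt_iff_lt_pow one_lt_two hn).2 h2
    have : 0 < 2 ^ m := by positivity
    exact (Nat.log_eq_iff (Or.inr ⟨one_lt_two, by omega⟩)).2 ⟨h3, h4⟩
  obtain ⟨x, hx⟩ := exists_letters_norm_sq_le (fun n => c (ψ n)) fun n => hc _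
  have hblock : ∀ m n, 2 ^ 2 ^ m ≤ n → n ≤ 2 ^ 2 ^ (m + 1) →
      ‖letterCount x n - (n : ℝ) • c m‖ ^ 2 ≤
        ‖letterCount x (2 ^ 2 ^ m) - ((2 ^ 2 ^ m : ℕ) : ℝ) • c m‖ ^ 2
          + 4 * ((n : ℝ) - ((2 ^ 2 ^ m : ℕ) : ℝ)) := by
    intro m n h1
    induction n, h1 using Nat.le_induction with
    | base => intro; simp
    | succ n hn ih =>
      intro h2
      have h3 := hx n
      rw [hψ m n hn (by omega)] at h3
      have h4 := ih (by omega)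
      push_cast at h4 ⊢
      linarith
  have hbound : ∀ m n, 2 ^ 2 ^ (m + 1) ≤ n → n ≤ 2 ^ 2 ^ (m + 2) →
      ‖letterCount x n - (n : ℝ) • c (m + 1)‖ ≤
        n * (5 * (1 / ((2 ^ 2 ^ m : ℕ) : ℝ)) + dist (c m) (c (m + 1))) := by
    intro m n h1 h2
    set δ := dist (c m) (c (m + 1)) with hδ
    have hδ0 : 0 ≤ δ := dist_nonneg
    have hsq : 2 ^ 2 ^ (m + 1) = (2 ^ 2 ^ m) ^ 2 := by rw [← pow_mul, pow_succ]
    have ha0 : 0 < 2 ^ 2 ^ m := by positivity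
    have h3 := hblock m (2 ^ 2 ^ (m + 1)) (Nat.pow_le_pow_right two_pos
      (Nat.pow_le_pow_right two_pos m.le_succ)) le_rfl
    have h4 := hblock (m + 1) n h1 h2
    have h5 : ‖letterCount x (2 ^ 2 ^ m) - ((2 ^ 2 ^ m : ℕ) : ℝ) • c m‖ ≤
        2 * ((2 ^ 2 ^ m : ℕ) : ℝ) := by
      refine (norm_sub_le _ _).trans ?_
      rw [norm_smul, Real.norm_natCast]
      have := norm_letterCount_le x (2 ^ 2 ^ m)
      have := norm_le_one_of_mem_simplex (hc m)
      nlinarith [(Nat.cast_nonneg (2 ^ 2 ^ m) : (0 : ℝ) ≤ _)]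
    rw [hsq] at h1 h3 h4
    generalize 2 ^ 2 ^ m = a at h1 h3 h4 h5 ha0 ⊢
    have ha : (0 : ℝ) < a := by exact_mod_cast ha0
    have hn : (a : ℝ) ^ 2 ≤ n := by exact_mod_cast h1
    -- The squared error is at most `(2a)² + 4(a² - a) ≤ 9a²`.
    have h6 : ‖letterCount x (a ^ 2) - ((a ^ 2 : ℕ) : ℝ) • c m‖ ≤ 3 * a := by
      refine abs_le_of_sq_le_sq' ?_ (by positivity) |>.2
      push_cast at h3 ⊢
      nlinarith [norm_nonneg (letterCount x a - (a : ℝ) • c m)]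
    have h7 : ‖letterCount x (a ^ 2) - ((a ^ 2 : ℕ) : ℝ) • c (m + 1)‖ ≤ 3 * a + a ^ 2 * δ := by
      have h8 : letterCount x (a ^ 2) - ((a ^ 2 : ℕ) : ℝ) • c (m + 1) =
          (letterCount x (a ^ 2) - ((a ^ 2 : ℕ) : ℝ) • c m)
            + ((a ^ 2 : ℕ) : ℝ) • (c m - c (m + 1)) := by
        rw [smul_sub]; abel
      rw [h8]
      refine (norm_add_le _ _).trans (add_le_add h6 ?_)
      rw [norm_smul, Real.norm_natCast, ← dist_eq_norm, ← hδ]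
      push_cast
      exact le_rfl
    obtain ⟨q, hq0, hq⟩ : ∃ q : ℝ, 0 < q ∧ a * q = 1 := ⟨1 / a, by positivity, by field_simp⟩
    have hq' : 1 / (a : ℝ) = q := by field_simp; linarith
    rw [hq']
    have hn0 : (0 : ℝ) ≤ n := Nat.cast_nonneg n
    have h8 : 3 * a + a ^ 2 * δ ≤ n * (3 * q + δ) := by
      calc 3 * a + a ^ 2 * δ = (a : ℝ) ^ 2 * (3 * q + δ) := by linear_combination (-3 * a) * hq
        _ ≤ _ := by gcongr
    -- This absorbs the growth `4(n - a²)` of the squared error into `(2nq)²`, turning the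
    -- coefficient 3 into 5.
    have h9 : (n : ℝ) ≤ (n * q) ^ 2 := by
      calc (n : ℝ) = (a : ℝ) ^ 2 * q ^ 2 * n := by rw [← mul_pow, hq]; ring
        _ ≤ n * q ^ 2 * n := by gcongr
        _ = _ := by ring
    refine abs_le_of_sq_le_sq' ?_ (by positivity) |>.2
    have h10 := pow_le_pow_left₀ (norm_nonneg _) (h7.trans h8) 2
    have h11 : (0 : ℝ) ≤ (n * q) * (n * (3 * q + δ)) := by positivity
    have h12 : (0 : ℝ) ≤ ((a ^ 2 : ℕ) : ℝ) := Nat.cast_nonneg _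
    nlinarith
  have hψtop : Tendsto ψ atTop atTop := by
    refine tendsto_atTop_atTop_of_monotone (fun i j h => Nat.log_mono_right (Nat.log_mono_right h))
      fun m => ⟨2 ^ 2 ^ m, (hψ m _ le_rfl ?_).ge⟩
    exact Nat.pow_lt_pow_right one_lt_two (Nat.pow_lt_pow_right one_lt_two m.lt_succ_self)
  have hψ1 : Tendsto (fun n => ψ (n + 1)) atTop atTop := hψtop.comp (tendsto_add_atTop_nat 1)
  -- The shift is due to `relFreq x n` averaging `n + 1` letters.
  refine ⟨x, fun n => ψ (n + 1), hψ1, fun m => ⟨2 ^ 2 ^ m - 1, ?_, ?_⟩, ?_⟩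
  · have h1 : 2 ^ m < 2 ^ 2 ^ m := Nat.lt_two_pow_self
    have h2 : m < 2 ^ m := Nat.lt_two_pow_self
    omega
  · have h0 : 0 < 2 ^ 2 ^ m := by positivity
    change ψ (2 ^ 2 ^ m - 1 + 1) = m
    rw [Nat.sub_add_cancel (show 1 ≤ 2 ^ 2 ^ m from h0)]
    exact hψ m _ le_rfl
      (Nat.pow_lt_pow_right one_lt_two (Nat.pow_lt_pow_right one_lt_two m.lt_succ_self))
  · have hB : Tendsto (fun m : ℕ => 5 * (1 / ((2 ^ 2 ^ m : ℕ) : ℝ)) + dist (c m) (c (m + 1)))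
        atTop (𝓝 0) := by
      have h1 : Tendsto (fun m : ℕ => 2 ^ 2 ^ m) atTop atTop :=
        tendsto_atTop_mono (fun m => (Nat.lt_two_pow_self.trans Nat.lt_two_pow_self).le) tendsto_id
      simpa using ((tendsto_one_div_atTop_nhds_zero_nat (𝕜 := ℝ)).comp h1 |>.const_mul 5).add hstep
    refine squeeze_zero' (.of_forall fun _ => dist_nonneg) ?_
      (hB.comp ((tendsto_sub_atTop_nat 1).comp hψ1))
    filter_upwards [hψ1.eventually_ge_atTop 1] with n hn
    obtain ⟨m, hm⟩ : ∃ m, ψ (n + 1) = m + 1 := ⟨ψ (n + 1) - 1, by omega⟩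
    have hlog : Nat.log 2 (n + 1) ≠ 0 := by
      intro h
      simp [ψ, h] at hm
    have h1 : 2 ^ 2 ^ (m + 1) ≤ n + 1 := by
      rw [← hm]
      exact (Nat.pow_le_pow_right two_pos (Nat.pow_log_le_self 2 hlog)).trans
        (Nat.pow_log_le_self 2 n.succ_ne_zero)
    have h2 : n + 1 < 2 ^ 2 ^ (m + 2) := by
      refine (Nat.lt_pow_succ_log_self one_lt_two _).trans_le (Nat.pow_le_pow_right two_pos ?_)
      have := Nat.lt_pow_succ_log_self one_lt_two (Nat.log 2 (n + 1))
      rw [show (Nat.log 2 (Nat.log 2 (n + 1))) = m + 1 from hm] at this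
      exact this
    have h3 := hbound m (n + 1) h1 h2.le
    simp only [Function.comp_apply, hm, Nat.add_sub_cancel]
    have hn0 : (0 : ℝ) < (n : ℝ) + 1 := by positivity
    have h4 : relFreq x n - c (m + 1) =
        ((n : ℝ) + 1)⁻¹ • (letterCount x (n + 1) - ((n + 1 : ℕ) : ℝ) • c (m + 1)) := by
      rw [relFreq_eq_smul_letterCount, smul_sub, smul_smul, Nat.cast_succ,
        inv_mul_cancel₀ hn0.ne', one_smul]
    rw [dist_eq_norm, h4, norm_smul, Real.norm_of_nonneg (by positivity),
      inv_mul_le_iff₀ hn0]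
    simpa using h3

/-! ### Closed connected sets as cluster sets, and the theorem -/

open Filter Topology in
theorem clusterPoints_eq_setOf_mapClusterPt {k : ℕ} {r : ℕ → EuclideanSpace ℝ (Fin k)}
    (hr : ∀ n, r n ∈ simplex k) : clusterPoints r = {z | MapClusterPt z atTop r} := by
  have h : ∀ z, MapClusterPt z atTop r ↔
      ∀ ε : ℝ, 0 < ε → {n : ℕ | r n ∈ simplexBall z ε}.Infinite := by
    intro z
    rw [Metric.nhds_basis_ball.mapClusterPt_iff_frequently]
    simp [Nat.frequently_atTop_iff_infinite, simplexBall, hr, dist_eq_norm]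
  ext z
  simp only [clusterPoints, Set.mem_ofPred_eq, h, and_iff_right_iff_imp]
  intro hz
  exact (isClosed_simplex k).mem_of_mapClusterPt ((h z).2 hz) (.of_forall hr)

open Filter Topology in
/-- Every nonempty closed connected subset of the simplex is the set of cluster points of the
relative frequencies of some sequence of letters. -/
theorem exists_clusterPoints_relFreq_eq {k : ℕ} {C : Set (EuclideanSpace ℝ (Fin k))}
    (hCs : C ⊆ simplex k) (hC : IsClosed C) (hconn : IsConnected C) :
    ∃ x : ℕ → Fin k, clusterPoints (relFreq x) = C := by
  have : PreconnectedSpace C := Subtype.preconnectedSpace hconn.isPreconnected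
  have : Nonempty C := hconn.nonempty.to_subtype
  obtain ⟨c, hstep, hcl⟩ := exists_seq_mapClusterPt_of_preconnectedSpace (X := C)
  obtain ⟨x, φ, hφ, hφs, hx⟩ := exists_tendsto_relFreq_sub
    (fun m => (c m : EuclideanSpace ℝ (Fin k))) (fun m => hCs (c m).2) hstep
  refine ⟨x, ?_⟩
  rw [clusterPoints_eq_setOf_mapClusterPt (relFreq_mem_simplex x)]
  ext z
  simp only [Set.mem_ofPred_eq, Metric.nhds_basis_ball.mapClusterPt_iff_frequently,
    Metric.mem_ball]
  constructor
  · intro hz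
    rw [← hC.closure_eq, Metric.mem_closure_iff]
    intro ε hε
    obtain ⟨n, h1, h2⟩ := ((hz (ε / 2) (half_pos hε)).and_eventually
      (hx.eventually_lt_const (half_pos hε))).exists
    exact ⟨_, (c (φ n)).2, by
      linarith [dist_triangle_left z (c (φ n) : EuclideanSpace ℝ (Fin k)) (relFreq x n)]⟩
  -- Since `φ` takes every value `m` at some time `n ≥ m`, no visit of `c` near `z` is missed.
  · intro hz ε hε
    obtain ⟨N, hN⟩ := eventually_atTop.1 (hx.eventually_lt_const (half_pos hε))
    rw [frequently_atTop]
    intro M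
    obtain ⟨m, hm, hmz⟩ := frequently_atTop.1 (mapClusterPt_iff_frequently.1 (hcl ⟨z, hz⟩) _
      (Metric.ball_mem_nhds _ (half_pos hε))) (max M N)
    obtain ⟨n, hn, hnm⟩ := hφs m
    have h1 := hN n (by omega)
    rw [hnm] at h1
    have h2 : dist (c m : EuclideanSpace ℝ (Fin k)) z < ε / 2 := hmz
    exact ⟨n, by omega, by
      linarith [dist_triangle (relFreq x n) (c m : EuclideanSpace ℝ (Fin k)) z]⟩

theorem mainTheorem2 (k : ℕ) (D : Set (EuclideanSpace ℝ (Fin k))) (hDsub : D ⊆ simplex k)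
    (hDconv : Convex ℝ D) (hDne : D.Nonempty) :
    ((3 ≤ k ∨ (k = 2 ∧ D.Subsingleton)) →
      ∃ x : ℕ → Fin k, clusterPoints (relFreq x) = planeBoundary D) ∧
    (2 ≤ Module.finrank ℝ (vectorSpan ℝ D) →
      ∃ x : ℕ → Fin k, clusterPoints (relFreq x) = intrinsicFrontier ℝ D) := by
  have hb : Bornology.IsBounded D := (isBounded_simplex k).subset hDsub
  have hcl : closure D ⊆ simplex k := closure_minimal hDsub (isClosed_simplex k)
  constructor
  · intro hk
    obtain ⟨A, hA, hrank⟩ := exists_affineSubspace_eq_simplexPlane (k := k) (by omega)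
    have hDA : D ⊆ A := hA ▸ fun z hz => (hDsub hz).2
    refine exists_clusterPoints_relFreq_eq
      ((image_frontier_preimage_subset_closure _ D).trans hcl)
      (isClosed_image_frontier_preimage (isClosed_simplexPlane k) D) ?_
    rw [planeBoundary, ← hA]
    rcases hk with hk | ⟨hk, hD⟩
    · refine A.isConnected_image_frontier_preimage ?_ hDA hDconv hDne hb
      rw [← Module.finrank_eq_rank]
      exact_mod_cast (by omega : 1 < Module.finrank ℝ A.direction)
    · have : Nontrivial A.direction := Module.nontrivial_of_finrank_pos (R := ℝ) (by omega)
      refine ⟨A.nonempty_image_frontier_preimage hDA hDne hb, Set.Subsingleton.isPreconnected ?_⟩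
      have := hD.closure
      exact this.anti (image_frontier_preimage_subset_closure _ D)
  · intro hk
    refine exists_clusterPoints_relFreq_eq
      ((image_frontier_preimage_subset_closure _ D).trans hcl)
      -- `intrinsicFrontier` unfolds to the image of the frontier taken inside the affine span.
      (isClosed_image_frontier_preimage (AffineSubspace.closed_of_finiteDimensional _) D) ?_
    refine (affineSpan ℝ D).isConnected_image_frontier_preimage ?_ (subset_affineSpan ℝ D)
      hDconv hDne hb
    rw [direction_affineSpan, ← Module.finrank_eq_rank]
    exact_mod_cast hk
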